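/- Let $K$ be an infinite field, let $n,r$ be arbitrary natural numbers, and let $E=K^n$, with its natural action of $\mathsf{GL}_n=\mathsf{GL}_n(K)$. The symmetric group $\Sigma_r$ acts on the right of $E^{\otimes r}$ by place permutations, and $S_K(n,r)=\operatorname{End}_{\Sigma_r}(E^{\otimes r})$ is the Schur algebra. Let $\Lambda(n,r)=\{\lambda\in\mathbb N^n : \sum_i\lambda_i=r\}$. For $\lambda\in\Lambda(n,r)$ let $M^\lambda\subseteq E^{\otimes r}$ be the $\Sigma_r$-submodule spanned by the basis tensors $e_{i_1}\otimes\cdots\otimes e_{i_r}$ in which each $j\in\{1,\dots,n\}$ occurs exactly $\lambda_j$ times among $i_1,\dots,i_r$, and let $S^\lambda E=S^{\lambda_1}E\otimes\cdots\otimes S^{\lambda_n}E$, where $S^aE$ is the $a$-th symmetric power. Here $\mathsf{GL}_n$ acts on $S^\lambda E$ in the natural way, and $S_K(n,r)$ acts in the unique way for which the canonical surjection $E^{\otimes r}\to S^\lambda E$ is $S_K(n,r)$-linear. Put $S_K(\lambda)=\operatorname{End}_{\Sigma_r}(M^\lambda)$ and ${}_\lambda(S_K)_\mu=\operatorname{Hom}_{\Sigma_r}(M^\mu,M^\lambda)$;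 the latter is an $S_K(\lambda)$-$S_K(\mu)$ bimodule by composition. (a) For every $\lambda\in\Lambda(n,r)$ there are isomorphisms of $K$-algebras $$S_K(\lambda)\;\simeq\;\operatorname{End}_{S_K(n,r)}(S^\lambda E)\;\simeq\;\operatorname{End}_{\mathsf{GL}_n}(S^\lambda E),$$ the second of which is the identity on underlying linear maps. (b) The isomorphisms in (a) can be chosen so that for all $\lambda,\mu\in\Lambda(n,r)$ there are isomorphisms of $S_K(\lambda)$-$S_K(\mu)$ bimodules $${}_\lambda(S_K)_\mu\;\simeq\;\operatorname{Hom}_{S_K(n,r)}(S^\mu E,S^\lambda E)\;\simeq\;\operatorname{Hom}_{\mathsf{GL}_n}(S^\mu E,S^\lambda E),$$ where $S_K(\lambda)$ and $S_K(\mu)$ act on the last two spaces by composition through the isomorphisms in (a), and the second isomorphism is again the identity on underlying linear maps. -/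

import Mathlib

noncomputable section

namespace HeckeSchur

open MvPolynomial TensorProduct

/-- `Λ(n,r)`: the `n`-part compositions of `r` (zero parts allowed). -/
abbrev Weight (n r : ℕ) : Type := {l : Fin n → ℕ // ∑ j, l j = r}

/-- The weight `wt(i)` of a multi-index `i ∈ I(n,r)`: its `j`-th entry is the number of `k` with
`i_k = j`. -/
def wt {n r : ℕ} (i : Fin r → Fin n) (j : Fin n) : ℕ := Fintype.card {k // i k = j}

section Defs

variable (K : Type*) [Field K] (n r : ℕ)

/-- The natural module `E = K^n`. -/
abbrev E : Type _ := Fin n → K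

/-- The basis `e_1, …, e_n` of `E`. -/
abbrev stdBasis : Module.Basis (Fin n) K (E K n) := Pi.basisFun K (Fin n)

/-- Tensor space `E^{⊗ r}`. -/
abbrev TensorSpace : Type _ := ⨂[K] _ : Fin r, E K n

/-- The right action of `Σ_r` on tensor space by place permutations,
`(v_1 ⊗ ⋯ ⊗ v_r) · π = v_{π(1)} ⊗ ⋯ ⊗ v_{π(r)}`, as a representation of the opposite group. -/
def placeRep : Representation K (Equiv.Perm (Fin r))ᵐᵒᵖ (TensorSpace K n r) where
  toFun π := (PiTensorProduct.reindex K (fun _ => E K n) π.unop⁻¹).toLinearMap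
  map_one' := by
    refine PiTensorProduct.ext (MultilinearMap.ext fun v => ?_)
    simp only [LinearMap.compMultilinearMap_apply, LinearEquiv.coe_coe,
      PiTensorProduct.reindex_tprod]
    rfl
  map_mul' π σ := by
    refine PiTensorProduct.ext (MultilinearMap.ext fun v => ?_)
    simp only [LinearMap.compMultilinearMap_apply, LinearEquiv.coe_coe, Module.End.mul_apply,
      PiTensorProduct.reindex_tprod]
    rfl

variable {n r} in
theorem placeRep_tprod (π : (Equiv.Perm (Fin r))ᵐᵒᵖ) (v : Fin r → E K n) :
    placeRep K n r π (PiTensorProduct.tprod K v) =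
      PiTensorProduct.tprod K fun k => v (π.unop k) := by
  simp [placeRep, Equiv.Perm.inv_def]

/-- The Schur algebra `S_K(n,r) = End_{Σ_r}(E^{⊗ r})`. -/
abbrev SchurAlgebra : Type _ :=
  Representation.IntertwiningMap (placeRep K n r) (placeRep K n r)

variable {n r} in
/-- The basis element `e_i = e_{i_1} ⊗ ⋯ ⊗ e_{i_r}` of tensor space. -/
def tensorBasisVec (i : Fin r → Fin n) : TensorSpace K n r :=
  PiTensorProduct.tprod K fun k => stdBasis K n (i k)

variable {n r} in
theorem wt_comp_perm (i : Fin r → Fin n) (π : Equiv.Perm (Fin r)) :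
    wt (fun k => i (π k)) = wt i := by
  funext j
  exact Fintype.card_congr (π.subtypeEquiv fun _ => Iff.rfl)

variable {n r} in
/-- The permutation module `M^λ`, spanned by the `e_i` with `wt(i) = λ`, as a `Σ_r`-submodule of
tensor space. -/
def permSub (lam : Weight n r) : Subrepresentation (placeRep K n r) where
  toSubmodule := Submodule.span K {x | ∃ i : Fin r → Fin n, wt i = lam.1 ∧ x = tensorBasisVec K i}
  apply_mem_toSubmodule π v hv := by
    refine Submodule.mem_comap.1 (Submodule.span_le.2 ?_ hv)
    rintro _ ⟨i, hi, rfl⟩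
    refine Submodule.subset_span ⟨fun k => i (π.unop k), ?_, ?_⟩
    · rw [wt_comp_perm, hi]
    · simp [tensorBasisVec, placeRep_tprod]

variable {n r} in
/-- `M^λ` as a right `K Σ_r`-module. -/
abbrev permRep (lam : Weight n r) :
    Representation K (Equiv.Perm (Fin r))ᵐᵒᵖ (permSub K lam).toSubmodule :=
  (permSub K lam).toRepresentation

variable {n r} in
/-- `_λ(S_K)_μ = Hom_{Σ_r}(M^μ, M^λ)`. -/
abbrev HeckeHom (lam mu : Weight n r) : Type _ :=
  Representation.IntertwiningMap (permRep K mu) (permRep K lam)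

variable {n r} in
/-- The algebra `S_K(λ) = End_{Σ_r}(M^λ)`, with composition as multiplication. -/
abbrev HeckeAlgebra (lam : Weight n r) : Type _ := HeckeHom K lam lam

/-! ### Symmetric powers -/

/-- The symmetric power `S^a E`: the polynomials in the `e_i` (here the variables `X i`),
homogeneous of degree `a`. -/
abbrev SymPower (a : ℕ) : Type _ := homogeneousSubmodule (Fin n) K a

/-- The identification of `E` with the linear polynomials, `e_i ↦ X i`. -/
def linForm : E K n →ₗ[K] MvPolynomial (Fin n) K :=
  Fintype.linearCombination K (X : Fin n → MvPolynomial (Fin n) K)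

variable {n} in
theorem linForm_isHomogeneous (v : E K n) : (linForm K n v).IsHomogeneous 1 := by
  rw [linForm, Fintype.linearCombination_apply]
  refine IsHomogeneous.sum _ _ _ fun i _ => ?_
  rw [smul_eq_C_mul]
  exact (isHomogeneous_X K i).C_mul _

variable {n} in
/-- The linear substitution `e_j ↦ g e_j = ∑_i g_{ij} e_i` on polynomials. -/
def subst (g : Matrix (Fin n) (Fin n) K) :
    MvPolynomial (Fin n) K →ₐ[K] MvPolynomial (Fin n) K :=
  aeval fun j => linForm K n (g.mulVec (stdBasis K n j))

variable {n} in
theorem subst_linForm (g : Matrix (Fin n) (Fin n) K) (v : E K n) :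
    subst K g (linForm K n v) = linForm K n (g.mulVec v) := by
  have h : (subst K g).toLinearMap ∘ₗ linForm K n = linForm K n ∘ₗ g.mulVecLin := by
    refine (stdBasis K n).ext fun j => ?_
    simp [subst, linForm]
  exact LinearMap.congr_fun h v

variable {n} in
theorem subst_mem (g : Matrix (Fin n) (Fin n) K) (a : ℕ) {p : MvPolynomial (Fin n) K}
    (hp : p ∈ homogeneousSubmodule (Fin n) K a) :
    subst K g p ∈ homogeneousSubmodule (Fin n) K a := by
  have := IsHomogeneous.aeval (S := K) (n := 1) hp _
    fun j => linForm_isHomogeneous K (g.mulVec (stdBasis K n j))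
  rwa [one_mul] at this

/-- The action of the monoid `M_n(K)` on `S^a E` by linear substitutions. -/
def symRep (a : ℕ) : Representation K (Matrix (Fin n) (Fin n) K) (SymPower K n a) where
  toFun g := (subst K g).toLinearMap.restrict fun _ hp => subst_mem K g a hp
  map_one' := by
    refine LinearMap.ext fun p => Subtype.ext ?_
    have : subst K (1 : Matrix (Fin n) (Fin n) K) = AlgHom.id K _ := by
      refine algHom_ext fun j => ?_
      have : X j = linForm K n (stdBasis K n j) := by simp [linForm]
      rw [this, subst_linForm, Matrix.one_mulVec, AlgHom.id_apply]
    simp [this]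
  map_mul' g h := by
    refine LinearMap.ext fun p => Subtype.ext ?_
    have : subst K (g * h) = (subst K g).comp (subst K h) := by
      refine algHom_ext fun j => ?_
      have : X j = linForm K n (stdBasis K n j) := by simp [linForm]
      rw [this, AlgHom.comp_apply, subst_linForm, subst_linForm, subst_linForm,
        Matrix.mulVec_mulVec]
    change subst K (g * h) p = subst K g (subst K h p)
    rw [this, AlgHom.comp_apply]

variable {n r}

/-- The generalized symmetric power `S^λ E = S^{λ_1} E ⊗ ⋯ ⊗ S^{λ_n} E`. -/
def GenSymPower (lam : Weight n r) : Type _ := ⨂[K] j : Fin n, SymPower K n (lam.1 j)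

instance (lam : Weight n r) : AddCommGroup (GenSymPower K lam) :=
  inferInstanceAs (AddCommGroup (⨂[K] j : Fin n, SymPower K n (lam.1 j)))

instance (lam : Weight n r) : Module K (GenSymPower K lam) :=
  inferInstanceAs (Module K (⨂[K] j : Fin n, SymPower K n (lam.1 j)))

/-- The action of `M_n(K)` on `S^λ E`. -/
def monRep (lam : Weight n r) :
    Representation K (Matrix (Fin n) (Fin n) K) (GenSymPower K lam) where
  toFun g := PiTensorProduct.map fun j => symRep K n (lam.1 j) g
  map_one' := by simp; rfl
  map_mul' g h := by
    simp only [map_mul]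
    exact PiTensorProduct.map_mul _ _

/-- The action of `GL_n(K)` on `S^λ E`. -/
def glRep (lam : Weight n r) : Representation K (GL (Fin n) K) (GenSymPower K lam) :=
  (monRep K lam).comp (Units.coeHom _)

/-! ### The Schur algebra action on `S^λ E` -/

/-- The places `1, …, r` divided into consecutive blocks of sizes `λ_1, …, λ_n`. -/
def places (lam : Weight n r) : (Σ j : Fin n, Fin (lam.1 j)) ≃ Fin r :=
  finSigmaFinEquiv.trans (finCongr lam.2)

variable (n) in
/-- The multiplication `E × ⋯ × E → S^a E`. -/
def symMul (a : ℕ) : MultilinearMap K (fun _ : Fin a => E K n) (SymPower K n a) :=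
  ((MultilinearMap.mkPiAlgebra K (Fin a) (MvPolynomial (Fin n) K)).compLinearMap
    fun _ => linForm K n).codRestrict (homogeneousSubmodule (Fin n) K a) fun v => by
      have := IsHomogeneous.prod Finset.univ (fun k => linForm K n (v k)) (fun _ : Fin a => 1)
        fun k _ => linForm_isHomogeneous K (v k)
      simpa using this

theorem symMul_coe (a : ℕ) (v : Fin a → E K n) :
    (symMul K n a v : MvPolynomial (Fin n) K) = ∏ k, linForm K n (v k) := rfl

/-- The canonical surjection `E^{⊗ r} → S^λ E`, multiplying the factors within each block. -/
def toSym (lam : Weight n r) : TensorSpace K n r →ₗ[K] GenSymPower K lam :=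
  PiTensorProduct.lift (((PiTensorProduct.tprod K).compMultilinearMap
    fun j => symMul K n (lam.1 j)).domDomCongr (places lam))

theorem toSym_tprod (lam : Weight n r) (v : Fin r → E K n) :
    toSym K lam (PiTensorProduct.tprod K v) =
      PiTensorProduct.tprod K fun j => symMul K n (lam.1 j) fun a => v (places lam ⟨j, a⟩) := by
  unfold toSym
  erw [PiTensorProduct.lift.tprod]
  rfl

/-! A basis of `S^λ E` by tensor products of monomials. -/

/-- The monomial basis of `S^a E`. -/
def symBasis (n a : ℕ) : Module.Basis {d : Fin n →₀ ℕ // d.degree = a} K (SymPower K n a) :=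
  Module.Basis.ofRepr ((LinearEquiv.ofEq _ _
    (homogeneousSubmodule_eq_finsupp_supported (Fin n) K a)).trans
      (AddMonoidAlgebra.supportedEquivFinsupp {d : Fin n →₀ ℕ | d.degree = a}))

theorem symBasis_coe (a : ℕ) (d : {d : Fin n →₀ ℕ // d.degree = a}) :
    (symBasis K n a d : MvPolynomial (Fin n) K) = monomial d.1 1 := by
  have hm : monomial d.1 (1 : K) ∈ homogeneousSubmodule (Fin n) K a :=
    isHomogeneous_monomial 1 d.2
  have : symBasis K n a d = ⟨monomial d.1 1, hm⟩ := by
    rw [Module.Basis.apply_eq_iff]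
    ext d'
    change coeff d'.1 (monomial d.1 (1 : K)) = _
    classical
    rw [coeff_monomial, Finsupp.single_apply]
    simp only [Subtype.ext_iff]
  rw [this]

/-- The basis of `S^λ E` by tensor products of monomials. -/
def genSymBasis (lam : Weight n r) :
    Module.Basis (∀ j : Fin n, {d : Fin n →₀ ℕ // d.degree = lam.1 j}) K (GenSymPower K lam) :=
  Basis.piTensorProduct fun j => symBasis K n (lam.1 j)

/-- The basis `e_i` of tensor space. -/
def tensorBasis (n r : ℕ) : Module.Basis (Fin r → Fin n) K (TensorSpace K n r) :=
  Basis.piTensorProduct fun _ => stdBasis K n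

theorem tensorBasis_apply (i : Fin r → Fin n) : tensorBasis K n r i = tensorBasisVec K i :=
  Basis.piTensorProduct_apply _ _

/-- The exponents of the monomials whose tensor product is the image of `e_i` in `S^λ E`. -/
def expo (lam : Weight n r) (i : Fin r → Fin n) (j : Fin n) :
    {d : Fin n →₀ ℕ // d.degree = lam.1 j} :=
  ⟨∑ a : Fin (lam.1 j), Finsupp.single (i (places lam ⟨j, a⟩)) 1, by simp⟩

theorem toSym_tensorBasis (lam : Weight n r) (i : Fin r → Fin n) :
    toSym K lam (tensorBasis K n r i) = genSymBasis K lam (expo lam i) := by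
  rw [tensorBasis_apply, tensorBasisVec, toSym_tprod, genSymBasis]
  refine Eq.trans ?_ (Basis.piTensorProduct_apply _ _).symm
  congr 1
  funext j
  refine Subtype.ext ?_
  rw [symMul_coe, symBasis_coe, expo]
  simp only [linForm, Pi.basisFun_apply, Fintype.linearCombination_apply_single, one_smul]
  rw [monomial_sum_one]
  rfl

theorem exists_word (a : ℕ) (d : {d : Fin n →₀ ℕ // d.degree = a}) :
    ∃ w : Fin a → Fin n, ∑ k, Finsupp.single (w k) 1 = d.1 := by
  obtain ⟨d, hd⟩ := d
  induction a generalizing d with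
  | zero => exact ⟨Fin.elim0, by simpa using ((Finsupp.degree_eq_zero_iff d).1 hd).symm⟩
  | succ a ih =>
    have hne : d ≠ 0 := fun h => by simp [h] at hd
    obtain ⟨c, hc⟩ := Finsupp.ne_iff.1 hne
    have hle : Finsupp.single c 1 ≤ d := by
      rw [Finsupp.single_le_iff]
      exact Nat.one_le_iff_ne_zero.2 hc
    obtain ⟨d', rfl⟩ := exists_add_of_le hle
    have hd' : d'.degree = a := by
      rw [map_add, Finsupp.degree_single] at hd
      omega
    obtain ⟨w, hw⟩ := ih d' hd'
    refine ⟨Fin.cons c w, ?_⟩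
    simp only [Fin.sum_univ_succ, Fin.cons_zero, Fin.cons_succ] at hw ⊢
    rw [hw]

theorem exists_perm_word (a : ℕ) (w w' : Fin a → Fin n)
    (h : ∑ k, Finsupp.single (w k) 1 = (∑ k, Finsupp.single (w' k) 1 : Fin n →₀ ℕ)) :
    ∃ σ : Equiv.Perm (Fin a), ∀ k, w' (σ k) = w k := by
  have hc : ∀ c, Nonempty ({k // w k = c} ≃ {k // w' k = c}) := fun c => by
    have := DFunLike.congr_fun h c
    refine Fintype.card_eq.1 ?_
    simpa [Finsupp.finsetSum_apply, Finsupp.single_apply, Fintype.card_subtype] using this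
  exact ⟨Equiv.ofFiberEquiv fun c => (hc c).some, Equiv.ofFiberEquiv_map _⟩

theorem expo_surjective (lam : Weight n r) : Function.Surjective (expo lam) := by
  intro p
  choose w hw using fun j => exists_word (lam.1 j) (p j)
  refine ⟨fun k => (fun s : Σ j, Fin (lam.1 j) => w s.1 s.2) ((places lam).symm k), ?_⟩
  funext j
  refine Subtype.ext ?_
  refine (Finset.sum_congr rfl fun a _ => ?_).trans (hw j)
  exact congrArg (fun s : Σ j, Fin (lam.1 j) => Finsupp.single (w s.1 s.2) 1)
    ((places lam).symm_apply_apply ⟨j, a⟩)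

theorem toSym_surjective (lam : Weight n r) : Function.Surjective (toSym K lam) := by
  rw [← LinearMap.range_eq_top, ← top_le_iff, ← (genSymBasis K lam).span_eq, Submodule.span_le]
  rintro _ ⟨p, rfl⟩
  obtain ⟨i, rfl⟩ := expo_surjective lam p
  exact ⟨_, toSym_tensorBasis K lam i⟩

/-- The permutation of `Fin r` that permutes each block by a given permutation. -/
def blockPerm (lam : Weight n r) (σ : ∀ j, Equiv.Perm (Fin (lam.1 j))) : Equiv.Perm (Fin r) :=
  (places lam).symm.trans ((Equiv.sigmaCongrRight σ).trans (places lam))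

theorem toSym_placeRep (lam : Weight n r) (σ : ∀ j, Equiv.Perm (Fin (lam.1 j)))
    (x : TensorSpace K n r) :
    toSym K lam (placeRep K n r (.op (blockPerm lam σ)) x) = toSym K lam x := by
  have : toSym K lam ∘ₗ placeRep K n r (.op (blockPerm lam σ)) = toSym K lam := by
    refine PiTensorProduct.ext (MultilinearMap.ext fun v => ?_)
    simp only [LinearMap.compMultilinearMap_apply, LinearMap.comp_apply, placeRep_tprod,
      toSym_tprod]
    congr 1
    funext j
    refine Subtype.ext ?_
    rw [symMul_coe, symMul_coe]
    refine Fintype.prod_equiv (σ j) _ _ fun a => ?_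
    simp [blockPerm]
  exact LinearMap.congr_fun this x

theorem toSym_schur_congr (lam : Weight n r) (ξ : SchurAlgebra K n r) (i i' : Fin r → Fin n)
    (h : expo lam i = expo lam i') :
    toSym K lam (ξ (tensorBasis K n r i)) = toSym K lam (ξ (tensorBasis K n r i')) := by
  choose σ hσ using fun j => exists_perm_word _ _ _ (congrArg Subtype.val (congrFun h j))
  have hi : tensorBasis K n r i
      = placeRep K n r (.op (blockPerm lam σ)) (tensorBasis K n r i') := by
    rw [tensorBasis_apply, tensorBasis_apply, tensorBasisVec, tensorBasisVec, placeRep_tprod]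
    congr 1
    funext k
    obtain ⟨⟨j, a⟩, rfl⟩ := (places lam).surjective k
    have := hσ j a
    simp [blockPerm, this]
  rw [hi, ξ.isIntertwining, toSym_placeRep]

theorem exists_schurAct (lam : Weight n r) (ξ : SchurAlgebra K n r) :
    ∃ f : Module.End K (GenSymPower K lam), ∀ x, f (toSym K lam x) = toSym K lam (ξ x) := by
  choose s hs using expo_surjective (n := n) lam
  refine ⟨(genSymBasis K lam).constr K fun p => toSym K lam (ξ (tensorBasis K n r (s p))), ?_⟩
  intro x
  have : ((genSymBasis K lam).constr K fun p => toSym K lam (ξ (tensorBasis K n r (s p)))) ∘ₗ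
      toSym K lam = toSym K lam ∘ₗ ξ.toLinearMap := by
    refine (tensorBasis K n r).ext fun i => ?_
    rw [LinearMap.comp_apply, toSym_tensorBasis, Module.Basis.constr_basis]
    exact toSym_schur_congr K lam ξ _ _ (hs _)
  exact LinearMap.congr_fun this x

/-- The action of `ξ ∈ S_K(n,r)` on `S^λ E`: the unique endomorphism compatible with the action of
`ξ` on tensor space and the canonical surjection `E^{⊗ r} → S^λ E`. -/
def schurAct (lam : Weight n r) (ξ : SchurAlgebra K n r) : Module.End K (GenSymPower K lam) :=
  (exists_schurAct K lam ξ).choose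

theorem schurAct_toSym (lam : Weight n r) (ξ : SchurAlgebra K n r) (x : TensorSpace K n r) :
    schurAct K lam ξ (toSym K lam x) = toSym K lam (ξ x) :=
  (exists_schurAct K lam ξ).choose_spec x

instance (lam : Weight n r) : Module (SchurAlgebra K n r) (GenSymPower K lam) where
  smul ξ y := schurAct K lam ξ y
  one_smul y := by
    obtain ⟨x, rfl⟩ := toSym_surjective K lam y
    exact schurAct_toSym K lam 1 x
  mul_smul ξ η y := by
    obtain ⟨x, rfl⟩ := toSym_surjective K lam y
    change schurAct K lam _ _ = schurAct K lam _ (schurAct K lam _ _)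
    rw [schurAct_toSym, schurAct_toSym, schurAct_toSym]
    rfl
  smul_zero ξ := map_zero (schurAct K lam ξ)
  smul_add ξ := map_add (schurAct K lam ξ)
  add_smul ξ η y := by
    obtain ⟨x, rfl⟩ := toSym_surjective K lam y
    change schurAct K lam _ _ = schurAct K lam _ _ + schurAct K lam _ _
    rw [schurAct_toSym, schurAct_toSym, schurAct_toSym, ← map_add]
    rfl
  zero_smul y := by
    obtain ⟨x, rfl⟩ := toSym_surjective K lam y
    change schurAct K lam _ _ = _
    rw [schurAct_toSym]
    exact map_zero _

theorem smul_toSym (lam : Weight n r) (ξ : SchurAlgebra K n r) (x : TensorSpace K n r) :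
    ξ • toSym K lam x = toSym K lam (ξ x) := schurAct_toSym K lam ξ x

instance (lam : Weight n r) : IsScalarTower K (SchurAlgebra K n r) (GenSymPower K lam) where
  smul_assoc c ξ y := by
    obtain ⟨x, rfl⟩ := toSym_surjective K lam y
    rw [smul_toSym, smul_toSym, ← map_smul]
    rfl

instance (lam : Weight n r) : SMulCommClass (SchurAlgebra K n r) K (GenSymPower K lam) where
  smul_comm ξ c y := map_smul (schurAct K lam ξ) c y

/-! The Schur algebra action extends the action of `M_n(K)`. -/

variable (n r) in
/-- The action `g ↦ g ⊗ ⋯ ⊗ g` of `M_n(K)` on tensor space, as elements of the Schur algebra. -/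
def diag (g : Matrix (Fin n) (Fin n) K) : SchurAlgebra K n r where
  toLinearMap := PiTensorProduct.map fun _ => g.mulVecLin
  isIntertwining' π := by
    refine PiTensorProduct.ext (MultilinearMap.ext fun v => ?_)
    simp [placeRep_tprod]

theorem diag_smul (lam : Weight n r) (g : Matrix (Fin n) (Fin n) K) (y : GenSymPower K lam) :
    diag K n r g • y = monRep K lam g y := by
  obtain ⟨x, rfl⟩ := toSym_surjective K lam y
  rw [smul_toSym]
  have : toSym K lam ∘ₗ (diag K n r g).toLinearMap = monRep K lam g ∘ₗ toSym K lam := by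
    refine PiTensorProduct.ext (MultilinearMap.ext fun v => ?_)
    simp only [LinearMap.compMultilinearMap_apply, LinearMap.comp_apply, diag,
      PiTensorProduct.map_tprod, toSym_tprod]
    refine Eq.trans ?_ (PiTensorProduct.map_tprod _ _).symm
    congr 1
    funext j
    refine Subtype.ext ?_
    change _ = subst K g (symMul K n (lam.1 j) _ : MvPolynomial (Fin n) K)
    rw [symMul_coe, symMul_coe, map_prod]
    simp only [subst_linForm, Matrix.mulVecLin_apply]
  exact LinearMap.congr_fun this x

end Defs

end HeckeSchur

end

open HeckeSchur

/-! M^λ is the permutation module on the cosets of a Young subgroup, and S^λ E consists of the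
coinvariants of E^{⊗r} under that subgroup. So S^λ E is the space of Σ_r-coinvariants of E^{⊗r} ⊗
M^λ, with x ⊗ m realised by `pairing`. A homomorphism f : M^μ → M^λ therefore induces x ⊗ m ↦ x ⊗
f(m) from S^μ E to S^λ E. This map is linear over the Schur algebra, which acts on the first factor
only, and the construction respects composition (`schurHom_comp`); that gives both the algebra and
the bimodule structure.

Bijectivity rests on one functional, `diagCoord`, the coefficient of e_1^{λ_1} ⊗ ⋯ ⊗ e_n^{λ_n}. Its
translates by the Schur algebra include every coordinate (`diagCoord_orbitElt`), so an
S_K(n,r)-linear h into S^λ E is determined by the scalar-valued map `diagCoord` ∘ h, which vanishes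
on all weight spaces except that of weight λ. On the other hand, `diagCoord` applied to e_i ⊗ m is
the coefficient of e_i in m (`diagCoord_pairing_eq_repr`). Hence f is recovered from its induced
map, and any h yields a Σ_r-invariant matrix that defines its preimage.

For GL_n, the matrix entries of g ⊗ ⋯ ⊗ g are monomials in the entries of g, distinct orbits of
pairs of words giving distinct monomials. Over an infinite field a polynomial vanishing on GL_n is
zero, so no nonzero functional on the Schur algebra kills all g ⊗ ⋯ ⊗ g
(`linearMap_eq_zero_of_diag`). Equivariance under GL_n therefore implies linearity over the Schur
algebra. -/

noncomputable section

namespace HeckeSchur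

open MvPolynomial TensorProduct

/-! ### Orbits of words and of pairs of words under place permutations -/

section Words

variable {n r : ℕ}

/-- The multiset of letter pairs `(l_p, k_p)` of two words: a complete invariant of the
simultaneous action of `Σ_r` on pairs of words. -/
def pairCount (l k : Fin r → Fin n) : Fin n × Fin n →₀ ℕ := ∑ p, Finsupp.single (l p, k p) 1

theorem pairCount_comp_perm (l k : Fin r → Fin n) (π : Equiv.Perm (Fin r)) :
    pairCount (l ∘ π) (k ∘ π) = pairCount l k :=
  Equiv.sum_comp π fun p => Finsupp.single (l p, k p) 1

theorem pairCount_apply (l k : Fin r → Fin n) (x : Fin n × Fin n) :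
    pairCount l k x = Fintype.card {p // (l p, k p) = x} := by
  simp [pairCount, Finsupp.finsetSum_apply, Finsupp.single_apply, Fintype.card_subtype]

theorem exists_perm_of_card_fiber_eq {α : Type*} [DecidableEq α] (w w' : Fin r → α)
    (h : ∀ c, Fintype.card {k // w k = c} = Fintype.card {k // w' k = c}) :
    ∃ π : Equiv.Perm (Fin r), w' ∘ π = w := by
  have hc := fun c => Fintype.card_eq.1 (h c)
  exact ⟨Equiv.ofFiberEquiv fun c => (hc c).some, funext (Equiv.ofFiberEquiv_map _)⟩

theorem exists_perm_of_pairCount_eq {l k l' k' : Fin r → Fin n}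
    (h : pairCount l k = pairCount l' k') :
    ∃ π : Equiv.Perm (Fin r), l' ∘ π = l ∧ k' ∘ π = k := by
  obtain ⟨π, hπ⟩ := exists_perm_of_card_fiber_eq (fun p => (l p, k p)) (fun p => (l' p, k' p))
    fun x => by rw [← pairCount_apply, ← pairCount_apply, h]
  exact ⟨π, funext fun p => congrArg Prod.fst (congrFun hπ p),
    funext fun p => congrArg Prod.snd (congrFun hπ p)⟩

/-- The permutation carrying (l, l) to (l, k) acts in the same way on both components. This makes
e_1^{λ_1} ⊗ ⋯ ⊗ e_n^{λ_n} the image of exactly one basis tensor. -/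
theorem eq_of_pairCount_self {l k : Fin r → Fin n} (h : pairCount l k = pairCount l l) :
    k = l := by
  obtain ⟨π, h1, h2⟩ := exists_perm_of_pairCount_eq h
  exact h2.symm.trans h1

theorem exists_perm_of_wt_eq {w w' : Fin r → Fin n} (h : wt w = wt w') :
    ∃ π : Equiv.Perm (Fin r), w' ∘ π = w :=
  exists_perm_of_card_fiber_eq w w' fun c => congrFun h c

theorem wt_comp (i : Fin r → Fin n) (π : Equiv.Perm (Fin r)) : wt (i ∘ π) = wt i :=
  wt_comp_perm i π

/-- The word of weight `λ` whose letters are weakly increasing. -/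
def canonWord (lam : Weight n r) (p : Fin r) : Fin n := ((places lam).symm p).1

theorem wt_canonWord (lam : Weight n r) : wt (canonWord lam) = lam.1 := by
  funext j
  have h : wt (canonWord lam) j = ∑ p, if canonWord lam p = j then 1 else 0 := by
    simp [wt, Fintype.card_subtype]
  rw [h, ← (places lam).sum_comp, Fintype.sum_sigma]
  simp [canonWord]

/-- Block j consists of the places where `canonWord lam` has letter j. Monomial basis elements of
S^λ E thus correspond to orbits of pairs whose first word can be taken to be `canonWord lam`. -/
theorem expo_apply (lam : Weight n r) (i : Fin r → Fin n) (j c : Fin n) :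
    (expo lam i j).1 c = pairCount (canonWord lam) i (j, c) := by
  rw [pairCount, ← (places lam).sum_comp, Fintype.sum_sigma]
  simp only [expo, canonWord, Equiv.symm_apply_apply, Finsupp.finsetSum_apply,
    Finsupp.single_apply, Prod.mk.injEq]
  rw [Finset.sum_eq_single j]
  · simp
  · intro b _ hb
    simp [hb]
  · simp

theorem expo_eq_iff (lam : Weight n r) (i i' : Fin r → Fin n) :
    expo lam i = expo lam i' ↔
      pairCount (canonWord lam) i = pairCount (canonWord lam) i' := by
  constructor
  · intro h
    ext ⟨j, c⟩
    rw [← expo_apply, ← expo_apply, h]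
  · intro h
    funext j
    refine Subtype.ext (Finsupp.ext fun c => ?_)
    rw [expo_apply, expo_apply, h]

end Words

variable (K : Type*) [Field K] {n r : ℕ}

theorem placeRep_tensorBasis (π : Equiv.Perm (Fin r)) (i : Fin r → Fin n) :
    placeRep K n r (.op π) (tensorBasis K n r i) = tensorBasis K n r (i ∘ π) := by
  rw [tensorBasis_apply, tensorBasis_apply, tensorBasisVec, placeRep_tprod]
  rfl

theorem placeRep_op_comp (π σ : Equiv.Perm (Fin r)) (x : TensorSpace K n r) :
    placeRep K n r (.op σ) (placeRep K n r (.op π) x) = placeRep K n r (.op (π * σ)) x := by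
  rw [MulOpposite.op_mul, map_mul]
  rfl

/-- The image of e_i depends only on the orbit of the pair (`canonWord lam`, i), and such a π moves
i while fixing the first word. -/
theorem toSym_placeRep_of_stab (lam : Weight n r) {π : Equiv.Perm (Fin r)}
    (hπ : canonWord lam ∘ π = canonWord lam) (x : TensorSpace K n r) :
    toSym K lam (placeRep K n r (.op π) x) = toSym K lam x := by
  have : toSym K lam ∘ₗ placeRep K n r (.op π) = toSym K lam := by
    refine (tensorBasis K n r).ext fun i => ?_
    rw [LinearMap.comp_apply, placeRep_tensorBasis, toSym_tensorBasis, toSym_tensorBasis,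
      (expo_eq_iff lam _ _).2]
    nth_rw 1 [← hπ]
    exact pairCount_comp_perm _ _ π
  exact LinearMap.congr_fun this x

/-! ### Elements of the Schur algebra as invariant matrices -/

section SchurOfMatrix

/-- The element of the Schur algebra given by a `Σ_r`-invariant matrix. -/
def schurOfMatrix (a : (Fin r → Fin n) → (Fin r → Fin n) → K)
    (ha : ∀ l k (π : Equiv.Perm (Fin r)), a (l ∘ π) (k ∘ π) = a l k) : SchurAlgebra K n r where
  toLinearMap := (tensorBasis K n r).constr K fun k => ∑ l, a l k • tensorBasis K n r l
  isIntertwining' π := by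
    refine (tensorBasis K n r).ext fun k => ?_
    rw [LinearMap.comp_apply, LinearMap.comp_apply, ← MulOpposite.op_unop π, placeRep_tensorBasis,
      Module.Basis.constr_basis, Module.Basis.constr_basis, map_sum]
    simp only [map_smul, placeRep_tensorBasis]
    refine (Fintype.sum_equiv (Equiv.arrowCongr π.unop.symm (Equiv.refl _)) _ _ fun l => ?_).symm
    change _ = a (l ∘ π.unop) (k ∘ π.unop) • tensorBasis K n r (l ∘ π.unop)
    rw [ha]

theorem schurOfMatrix_tensorBasis (a : (Fin r → Fin n) → (Fin r → Fin n) → K)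
    (ha : ∀ l k (π : Equiv.Perm (Fin r)), a (l ∘ π) (k ∘ π) = a l k) (k : Fin r → Fin n) :
    schurOfMatrix K a ha (tensorBasis K n r k) = ∑ l, a l k • tensorBasis K n r l :=
  (tensorBasis K n r).constr_basis _ _ _

variable {K} in
/-- The matrix entries of an element of the Schur algebra. -/
def entry (ξ : SchurAlgebra K n r) (l k : Fin r → Fin n) : K :=
  (tensorBasis K n r).repr (ξ (tensorBasis K n r k)) l

variable {K} in
theorem schur_tensorBasis (ξ : SchurAlgebra K n r) (k : Fin r → Fin n) :
    ξ (tensorBasis K n r k) = ∑ l, entry ξ l k • tensorBasis K n r l :=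
  ((tensorBasis K n r).sum_repr _).symm

theorem repr_placeRep (π : Equiv.Perm (Fin r)) (x : TensorSpace K n r) (l : Fin r → Fin n) :
    (tensorBasis K n r).repr (placeRep K n r (.op π) x) (l ∘ π) =
      (tensorBasis K n r).repr x l := by
  classical
  have : (tensorBasis K n r).coord (l ∘ π) ∘ₗ placeRep K n r (.op π) =
      (tensorBasis K n r).coord l := by
    refine (tensorBasis K n r).ext fun i => ?_
    simp only [LinearMap.comp_apply, placeRep_tensorBasis, Module.Basis.coord_apply,
      Module.Basis.repr_self, Finsupp.single_apply, π.surjective.injective_comp_right.eq_iff]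
  exact LinearMap.congr_fun this x

variable {K} in
theorem entry_comp_perm (ξ : SchurAlgebra K n r) (l k : Fin r → Fin n)
    (π : Equiv.Perm (Fin r)) : entry ξ (l ∘ π) (k ∘ π) = entry ξ l k := by
  rw [entry, ← placeRep_tensorBasis, ξ.isIntertwining, repr_placeRep]
  rfl

variable {K} in
theorem schur_ext {ξ η : SchurAlgebra K n r} (h : ∀ l k, entry ξ l k = entry η l k) : ξ = η := by
  refine Representation.IntertwiningMap.ext ((tensorBasis K n r).ext fun k => ?_)
  change ξ _ = η _
  simp only [schur_tensorBasis, h]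

theorem entry_schurOfMatrix (a : (Fin r → Fin n) → (Fin r → Fin n) → K)
    (ha : ∀ l k (π : Equiv.Perm (Fin r)), a (l ∘ π) (k ∘ π) = a l k) (l k : Fin r → Fin n) :
    entry (schurOfMatrix K a ha) l k = a l k := by
  classical
  rw [entry, schurOfMatrix_tensorBasis]
  simp [Finsupp.finsetSum_apply, Finsupp.single_apply]

/-- The basis element of the Schur algebra attached to an orbit of pairs of words. -/
def orbitElt (d : Fin n × Fin n →₀ ℕ) : SchurAlgebra K n r :=
  schurOfMatrix K (fun l k => if pairCount l k = d then 1 else 0) fun l k π => by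
    rw [pairCount_comp_perm]

theorem orbitElt_tensorBasis (d : Fin n × Fin n →₀ ℕ) (k : Fin r → Fin n) :
    orbitElt K d (tensorBasis K n r k) =
      ∑ l, if pairCount l k = d then tensorBasis K n r l else 0 := by
  rw [orbitElt, schurOfMatrix_tensorBasis]
  simp only [ite_smul, one_smul, zero_smul]

variable (n r) in
/-- The orbits of pairs of words. -/
def orbits : Finset (Fin n × Fin n →₀ ℕ) :=
  Finset.univ.image fun x : (Fin r → Fin n) × (Fin r → Fin n) => pairCount x.1 x.2

theorem pairCount_mem_orbits (l k : Fin r → Fin n) : pairCount l k ∈ orbits n r :=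
  Finset.mem_image.2 ⟨(l, k), Finset.mem_univ _, rfl⟩

theorem entry_sum {ι : Type*} (s : Finset ι) (c : ι → K) (ξ : ι → SchurAlgebra K n r)
    (l k : Fin r → Fin n) : entry (∑ d ∈ s, c d • ξ d) l k = ∑ d ∈ s, c d * entry (ξ d) l k := by
  simp [entry, Representation.IntertwiningMap.sum_apply, Finsupp.finsetSum_apply]

theorem schur_eq_sum_orbitElt (ξ : SchurAlgebra K n r) (c : (Fin n × Fin n →₀ ℕ) → K)
    (hc : ∀ l k, entry ξ l k = c (pairCount l k)) :
    ξ = ∑ d ∈ orbits n r, c d • orbitElt K d := by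
  refine schur_ext fun l k => ?_
  rw [entry_sum, hc]
  simp [orbitElt, entry_schurOfMatrix, pairCount_mem_orbits]

theorem exists_entry_eq (ξ : SchurAlgebra K n r) :
    ∃ c : (Fin n × Fin n →₀ ℕ) → K, ∀ l k, entry ξ l k = c (pairCount l k) := by
  -- The entry at a chosen representative of the orbit; the value 0 is taken only at exponents that
  -- no pair of words realises.
  refine ⟨fun d => if h : ∃ x : (Fin r → Fin n) × (Fin r → Fin n), pairCount x.1 x.2 = d
    then entry ξ h.choose.1 h.choose.2 else 0, fun l k => ?_⟩
  have h : ∃ x : (Fin r → Fin n) × (Fin r → Fin n), pairCount x.1 x.2 = pairCount l k :=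
    ⟨(l, k), rfl⟩
  refine Eq.trans ?_ (dif_pos h).symm
  obtain ⟨π, h1, h2⟩ := exists_perm_of_pairCount_eq h.choose_spec
  rw [← h1, ← h2, entry_comp_perm]

/-- Group the factors of ∏_p g_{l_p k_p} by letter pair: the label of an orbit is the exponent of a
monomial in the matrix entries. -/
theorem entry_diag (g : Matrix (Fin n) (Fin n) K) (l k : Fin r → Fin n) :
    entry (diag K n r g) l k = (pairCount l k).prod fun x e => g x.1 x.2 ^ e := by
  have h1 : diag K n r g (tensorBasis K n r k) =
      PiTensorProduct.tprod K fun p => g.mulVec (stdBasis K n (k p)) := by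
    rw [tensorBasis_apply, tensorBasisVec]
    exact PiTensorProduct.map_tprod _ _
  rw [entry, h1, tensorBasis, Basis.piTensorProduct_repr_tprod_apply, pairCount]
  refine Eq.trans ?_ (Finsupp.prod_finsetSum_index (fun x => pow_zero (g x.1 x.2))
    fun x a b => pow_add (g x.1 x.2) a b)
  simp

/-- A linear map on the Schur algebra that vanishes on `GL_n(K)` vanishes. -/
theorem linearMap_eq_zero_of_diag [Infinite K] (L : SchurAlgebra K n r →ₗ[K] K)
    (hL : ∀ g : GL (Fin n) K, L (diag K n r g) = 0) : L = 0 := by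
  -- The value of this polynomial at g is L(g ⊗ ⋯ ⊗ g), and its coefficients are the values of L on
  -- the orbit basis.
  have hp : (∑ d ∈ orbits n r, monomial d (L (orbitElt K d)) : MvPolynomial _ K) = 0 := by
    refine eq_of_eval_eq_on_gl fun g => ?_
    rw [map_zero, map_sum, ← hL g, schur_eq_sum_orbitElt K (diag K n r g.1)
      (fun d => d.prod fun x e => g.1 x.1 x.2 ^ e) fun l k => entry_diag K g.1 l k, map_sum]
    refine Finset.sum_congr rfl fun d _ => ?_
    rw [eval_monomial, map_smul, smul_eq_mul, mul_comm]
  refine LinearMap.ext fun ξ => ?_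
  obtain ⟨c, hc⟩ := exists_entry_eq K ξ
  rw [schur_eq_sum_orbitElt K ξ c hc, map_sum]
  refine Finset.sum_eq_zero fun d hd => ?_
  have := congrArg (coeff d) hp
  rw [coeff_sum] at this
  simp only [coeff_monomial, Finset.sum_ite_eq', hd, if_true, coeff_zero] at this
  rw [map_smul, this, smul_zero]

end SchurOfMatrix

/-! ### The restriction from the Schur algebra to the general linear group -/

variable {K} in
theorem diag_units_smul (lam : Weight n r) (g : GL (Fin n) K) (y : GenSymPower K lam) :
    diag K n r g.1 • y = glRep K lam g y := diag_smul K lam g.1 y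

variable {K} in
/-- For an infinite field, a `GL_n(K)`-equivariant map is linear over the Schur algebra. -/
theorem map_schur_smul [Infinite K] {lam mu : Weight n r}
    (h : Representation.IntertwiningMap (glRep K mu) (glRep K lam)) (ξ : SchurAlgebra K n r)
    (y : GenSymPower K mu) : h (ξ • y) = ξ • h y := by
  refine (genSymBasis K lam).ext_elem fun p => ?_
  -- The p-th coordinate of the failure of h to commute with ξ, as a linear functional of ξ.
  let L : SchurAlgebra K n r →ₗ[K] K :=
    (genSymBasis K lam).coord p ∘ₗ
      (h.toLinearMap ∘ₗ (LinearMap.toSpanSingleton (SchurAlgebra K n r) _ y).restrictScalars K -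
        (LinearMap.toSpanSingleton (SchurAlgebra K n r) _ (h y)).restrictScalars K)
  have hLξ (ξ : SchurAlgebra K n r) :
      L ξ = (genSymBasis K lam).coord p (h (ξ • y) - ξ • h y) := rfl
  have hL : L = 0 := linearMap_eq_zero_of_diag K L fun g => by
    rw [hLξ, diag_units_smul, diag_units_smul, h.isIntertwining, sub_self, map_zero]
  have := hLξ ξ
  rw [hL, map_sub] at this
  exact sub_eq_zero.1 this.symm

/-- Restriction from the Schur algebra to the general linear group. -/
def homGL [Infinite K] (lam mu : Weight n r) :
    (GenSymPower K mu →ₗ[SchurAlgebra K n r] GenSymPower K lam) ≃ₗ[K]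
      Representation.IntertwiningMap (glRep K mu) (glRep K lam) where
  toFun f := ⟨f.restrictScalars K, fun g => LinearMap.ext fun y => by
    change f (glRep K mu g y) = glRep K lam g (f y)
    rw [← diag_units_smul, ← diag_units_smul, map_smul]⟩
  map_add' f g := rfl
  map_smul' c f := rfl
  invFun h :=
    { toFun := h
      map_add' := map_add h
      map_smul' := map_schur_smul h }
  left_inv f := rfl
  right_inv h := rfl

/-- Restriction to the general linear group as an isomorphism of endomorphism algebras. -/
def endGL [Infinite K] (lam : Weight n r) :
    Module.End (SchurAlgebra K n r) (GenSymPower K lam) ≃ₐ[K]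
      Representation.IntertwiningMap (glRep K lam) (glRep K lam) :=
  AlgEquiv.ofLinearEquiv (homGL K lam lam) rfl fun _ _ => rfl

/-! ### Coinvariants of tensor space with a permutation module -/

section Pairing

/-- For a word `k` of weight `λ`, the map `x ↦ x ⊗ e_k` from tensor space to the
`Σ_r`-coinvariants of `E^{⊗ r} ⊗ M^λ`, which are identified with `S^λ E`. -/
def pairWord (lam : Weight n r) (k : Fin r → Fin n) : TensorSpace K n r →ₗ[K] GenSymPower K lam :=
  if h : wt (canonWord lam) = wt k then
    toSym K lam ∘ₗ placeRep K n r (.op (exists_perm_of_wt_eq h).choose)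
  else 0

/-- In the coinvariants x ⊗ e_k = xπ ⊗ e_{kπ}, so any π carrying e_k to the generator of M^λ may be
used: two choices differ by an element of the generator's stabiliser, which `toSym` ignores. -/
theorem pairWord_of_comp (lam : Weight n r) {k : Fin r → Fin n} {π : Equiv.Perm (Fin r)}
    (hπ : k ∘ π = canonWord lam) (x : TensorSpace K n r) :
    pairWord K lam k x = toSym K lam (placeRep K n r (.op π) x) := by
  have h : wt (canonWord lam) = wt k := by rw [← hπ, wt_comp]
  rw [pairWord, dif_pos h, LinearMap.comp_apply]
  have hσ := (exists_perm_of_wt_eq h).choose_spec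
  set σ := (exists_perm_of_wt_eq h).choose
  have hk : k = canonWord lam ∘ π.symm := by rw [← hπ, Function.comp_assoc]; simp
  have hs : canonWord lam ∘ ⇑(π⁻¹ * σ) = canonWord lam := by
    rw [hk] at hσ
    exact hσ
  rw [← toSym_placeRep_of_stab K lam hs (placeRep K n r (.op π) x), placeRep_op_comp,
    mul_inv_cancel_left]

theorem pairWord_of_wt_ne (lam : Weight n r) {k : Fin r → Fin n} (h : wt k ≠ lam.1) :
    pairWord K lam k = 0 :=
  dif_neg fun h' => h (by rw [← h', wt_canonWord])

theorem exists_comp_eq_canonWord (lam : Weight n r) {k : Fin r → Fin n} (h : wt k = lam.1) :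
    ∃ π : Equiv.Perm (Fin r), k ∘ π = canonWord lam :=
  exists_perm_of_wt_eq (by rw [h, wt_canonWord])

/-- If π carries e_k to the generator, then ρ⁻¹π carries e_{kρ} to it. -/
theorem pairWord_comp_perm (lam : Weight n r) (k : Fin r → Fin n) (ρ : Equiv.Perm (Fin r))
    (x : TensorSpace K n r) :
    pairWord K lam (k ∘ ρ) (placeRep K n r (.op ρ) x) = pairWord K lam k x := by
  by_cases h : wt k = lam.1
  · obtain ⟨π, hπ⟩ := exists_comp_eq_canonWord lam h
    have hρ : (k ∘ ρ) ∘ ⇑(ρ⁻¹ * π) = canonWord lam := by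
      rw [← hπ]
      funext p
      simp
    rw [pairWord_of_comp K lam hπ, pairWord_of_comp K lam hρ, placeRep_op_comp,
      mul_inv_cancel_left]
  · rw [pairWord_of_wt_ne K lam h, pairWord_of_wt_ne K lam (by rwa [wt_comp])]
    rfl

theorem pairWord_schur (lam : Weight n r) (k : Fin r → Fin n) (ξ : SchurAlgebra K n r)
    (x : TensorSpace K n r) : pairWord K lam k (ξ x) = ξ • pairWord K lam k x := by
  by_cases h : wt k = lam.1
  · obtain ⟨π, hπ⟩ := exists_comp_eq_canonWord lam h
    rw [pairWord_of_comp K lam hπ, pairWord_of_comp K lam hπ, smul_toSym, ξ.isIntertwining]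
  · rw [pairWord_of_wt_ne K lam h, LinearMap.zero_apply, LinearMap.zero_apply, smul_zero]

/-- The map `m ↦ (x ↦ x ⊗ m)` to the coinvariants of `E^{⊗ r} ⊗ M^λ`, which are identified with
`S^λ E`; it is extended by zero from `M^λ` to the whole tensor space. -/
def pairing (lam : Weight n r) :
    TensorSpace K n r →ₗ[K] TensorSpace K n r →ₗ[K] GenSymPower K lam :=
  (tensorBasis K n r).constr K (pairWord K lam)

theorem pairing_tensorBasis (lam : Weight n r) (k : Fin r → Fin n) :
    pairing K lam (tensorBasis K n r k) = pairWord K lam k :=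
  (tensorBasis K n r).constr_basis _ _ _

theorem pairing_canonWord (lam : Weight n r) (x : TensorSpace K n r) :
    pairing K lam (tensorBasis K n r (canonWord lam)) x = toSym K lam x := by
  rw [pairing_tensorBasis, pairWord_of_comp K lam (π := 1) rfl, MulOpposite.op_one, map_one]
  rfl

theorem pairing_placeRep (lam : Weight n r) (ρ : Equiv.Perm (Fin r)) (m x : TensorSpace K n r) :
    pairing K lam (placeRep K n r (.op ρ) m) (placeRep K n r (.op ρ) x) = pairing K lam m x := by
  have : (pairing K lam).compl₁₂ (placeRep K n r (.op ρ)) (placeRep K n r (.op ρ)) =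
      pairing K lam := by
    refine (tensorBasis K n r).ext fun k => LinearMap.ext fun x => ?_
    rw [LinearMap.compl₁₂_apply, placeRep_tensorBasis, pairing_tensorBasis, pairing_tensorBasis,
      pairWord_comp_perm]
  exact LinearMap.congr_fun₂ this m x

theorem pairing_schur (lam : Weight n r) (ξ : SchurAlgebra K n r) (m x : TensorSpace K n r) :
    pairing K lam m (ξ x) = ξ • pairing K lam m x := by
  have : (pairing K lam).flip (ξ x) = schurAct K lam ξ ∘ₗ (pairing K lam).flip x := by
    refine (tensorBasis K n r).ext fun k => ?_
    rw [LinearMap.comp_apply, LinearMap.flip_apply, LinearMap.flip_apply, pairing_tensorBasis]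
    exact pairWord_schur K lam k ξ x
  exact LinearMap.congr_fun this m

end Pairing

/-! ### The diagonal coefficient -/

section DiagCoord

/-- The coefficient of `e_1^{λ_1} ⊗ ⋯ ⊗ e_n^{λ_n}` on `S^λ E`. -/
def diagCoord (lam : Weight n r) : GenSymPower K lam →ₗ[K] K :=
  (genSymBasis K lam).coord (expo lam (canonWord lam))

theorem diagCoord_toSym (lam : Weight n r) (i : Fin r → Fin n) :
    diagCoord K lam (toSym K lam (tensorBasis K n r i)) = if i = canonWord lam then 1 else 0 := by
  classical
  rw [toSym_tensorBasis, diagCoord, Module.Basis.coord_apply, Module.Basis.repr_self,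
    Finsupp.single_apply]
  refine if_congr ⟨fun h => eq_of_pairCount_self ((expo_eq_iff lam _ _).1 h), ?_⟩ rfl rfl
  rintro rfl
  rfl

theorem diagCoord_pairing (lam : Weight n r) (k i : Fin r → Fin n) :
    diagCoord K lam (pairing K lam (tensorBasis K n r k) (tensorBasis K n r i)) =
      if i = k ∧ wt k = lam.1 then 1 else 0 := by
  rw [pairing_tensorBasis]
  by_cases h : wt k = lam.1
  · obtain ⟨π, hπ⟩ := exists_comp_eq_canonWord lam h
    rw [pairWord_of_comp K lam hπ, placeRep_tensorBasis, diagCoord_toSym, ← hπ]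
    simp only [π.surjective.injective_comp_right.eq_iff, h, and_true]
  · rw [pairWord_of_wt_ne K lam h]
    simp [h]

/-- Applied to e_k, the orbit element gives the sum of those e_l for which (l, k) lies in the orbit.
Only l = `canonWord lam` is seen by `diagCoord`, and it occurs exactly when e_k and e_i have the
same image in S^λ E. -/
theorem diagCoord_orbitElt (lam : Weight n r) (i : Fin r → Fin n) (y : GenSymPower K lam) :
    diagCoord K lam ((orbitElt K (pairCount (canonWord lam) i) : SchurAlgebra K n r) • y) =
      (genSymBasis K lam).coord (expo lam i) y := by
  classical
  obtain ⟨x, rfl⟩ := toSym_surjective K lam y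
  rw [smul_toSym]
  have : diagCoord K lam ∘ₗ toSym K lam ∘ₗ
      (orbitElt K (pairCount (canonWord lam) i) : SchurAlgebra K n r).toLinearMap =
      (genSymBasis K lam).coord (expo lam i) ∘ₗ toSym K lam := by
    refine (tensorBasis K n r).ext fun k => ?_
    change diagCoord K lam (toSym K lam (orbitElt K _ (tensorBasis K n r k))) =
      (genSymBasis K lam).coord (expo lam i) (toSym K lam (tensorBasis K n r k))
    rw [orbitElt_tensorBasis, map_sum, map_sum, toSym_tensorBasis, Module.Basis.coord_apply,
      Module.Basis.repr_self, Finsupp.single_apply,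
      Finset.sum_eq_single (canonWord lam)]
    · simp only [expo_eq_iff]
      split_ifs
      · rw [diagCoord_toSym, if_pos rfl]
      · rw [map_zero, map_zero]
    · intro l _ hl
      split_ifs
      · rw [diagCoord_toSym, if_neg hl]
      · rw [map_zero, map_zero]
    · simp
  exact LinearMap.congr_fun this x

/-- The functional `diagCoord` detects linear maps over the Schur algebra. -/
theorem schurHom_ext {lam mu : Weight n r}
    {f g : GenSymPower K mu →ₗ[SchurAlgebra K n r] GenSymPower K lam}
    (h : ∀ i, diagCoord K lam (f (toSym K mu (tensorBasis K n r i))) =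
      diagCoord K lam (g (toSym K mu (tensorBasis K n r i)))) : f = g := by
  have h' (y) : diagCoord K lam (f y) = diagCoord K lam (g y) := by
    obtain ⟨x, rfl⟩ := toSym_surjective K mu y
    have : diagCoord K lam ∘ₗ f.restrictScalars K ∘ₗ toSym K mu =
        diagCoord K lam ∘ₗ g.restrictScalars K ∘ₗ toSym K mu :=
      (tensorBasis K n r).ext h
    exact LinearMap.congr_fun this x
  refine LinearMap.ext fun y => (genSymBasis K lam).ext_elem fun p => ?_
  obtain ⟨i, rfl⟩ := expo_surjective lam p
  rw [← Module.Basis.coord_apply, ← Module.Basis.coord_apply, ← diagCoord_orbitElt,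
    ← diagCoord_orbitElt, ← map_smul, ← map_smul, h']

/-- The idempotent of the Schur algebra projecting tensor space to `M^λ`. -/
def weightIdem (lam : Weight n r) : SchurAlgebra K n r :=
  schurOfMatrix K (fun l k => if l = k ∧ wt k = lam.1 then 1 else 0) fun l k π => by
    rw [wt_comp]
    simp only [π.surjective.injective_comp_right.eq_iff]

theorem weightIdem_tensorBasis (lam : Weight n r) (k : Fin r → Fin n) :
    weightIdem K lam (tensorBasis K n r k) = if wt k = lam.1 then tensorBasis K n r k else 0 := by
  rw [weightIdem, schurOfMatrix_tensorBasis, Finset.sum_eq_single k]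
  · simp only [true_and, ite_smul, one_smul, zero_smul]
  · intro l _ hl
    rw [if_neg fun h => hl h.1, zero_smul]
  · simp

theorem diagCoord_weightIdem (lam : Weight n r) (y : GenSymPower K lam) :
    diagCoord K lam (weightIdem K lam • y) = diagCoord K lam y := by
  obtain ⟨x, rfl⟩ := toSym_surjective K lam y
  rw [smul_toSym]
  have : diagCoord K lam ∘ₗ toSym K lam ∘ₗ (weightIdem K lam).toLinearMap =
      diagCoord K lam ∘ₗ toSym K lam := by
    refine (tensorBasis K n r).ext fun k => ?_
    change diagCoord K lam (toSym K lam (weightIdem K lam (tensorBasis K n r k))) =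
      diagCoord K lam (toSym K lam (tensorBasis K n r k))
    rw [weightIdem_tensorBasis]
    split_ifs with h
    · rfl
    · rw [diagCoord_toSym, if_neg, map_zero, map_zero]
      rintro rfl
      exact h (wt_canonWord lam)
  exact LinearMap.congr_fun this x

/-- `diagCoord` is unchanged by the projector `weightIdem K lam`, which commutes with h and kills
e_i. -/
theorem diagCoord_eq_zero_of_wt_ne {lam mu : Weight n r}
    (h : GenSymPower K mu →ₗ[SchurAlgebra K n r] GenSymPower K lam) {i : Fin r → Fin n}
    (hi : wt i ≠ lam.1) : diagCoord K lam (h (toSym K mu (tensorBasis K n r i))) = 0 := by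
  rw [← diagCoord_weightIdem, ← map_smul, smul_toSym, weightIdem_tensorBasis, if_neg hi, map_zero,
    map_zero, map_zero]

end DiagCoord

/-! ### From homomorphisms of permutation modules to homomorphisms over the Schur algebra -/

theorem tensorBasis_mem_permSub (lam : Weight n r) {k : Fin r → Fin n} (hk : wt k = lam.1) :
    tensorBasis K n r k ∈ (permSub K lam).toSubmodule :=
  Submodule.subset_span ⟨k, hk, tensorBasis_apply K k⟩

/-- The basis element `e_k` of `M^λ`, for a word `k` of weight `λ`. -/
def permVec (lam : Weight n r) (k : Fin r → Fin n) (hk : wt k = lam.1) :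
    (permSub K lam).toSubmodule :=
  ⟨tensorBasis K n r k, tensorBasis_mem_permSub K lam hk⟩

theorem permRep_permVec (lam : Weight n r) {k l : Fin r → Fin n} (hk : wt k = lam.1)
    (hl : wt l = lam.1) (π : Equiv.Perm (Fin r)) (h : k ∘ π = l) :
    permRep K lam (.op π) (permVec K lam k hk) = permVec K lam l hl := by
  subst h
  exact Subtype.ext (placeRep_tensorBasis K π k)

variable {K} in
/-- Two linear maps on `M^λ` agree if they agree on the basis elements `e_k`. -/
theorem permSub_hom_ext {W : Type*} [AddCommMonoid W] [Module K W] {lam : Weight n r}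
    {f g : (permSub K lam).toSubmodule →ₗ[K] W}
    (h : ∀ k hk, f (permVec K lam k hk) = g (permVec K lam k hk)) : f = g := by
  refine LinearMap.ext fun ⟨m, hm⟩ => ?_
  refine Submodule.span_induction (p := fun m hm => f ⟨m, hm⟩ = g ⟨m, hm⟩) ?_ ?_ ?_ ?_ hm
  · rintro _ ⟨k, hk, rfl⟩
    have := h k hk
    simp only [permVec, tensorBasis_apply] at this
    exact this
  · exact (map_zero f).trans (map_zero g).symm
  · intro x y hx hy h1 h2
    exact (map_add f ⟨x, hx⟩ ⟨y, hy⟩).trans ((congrArg₂ _ h1 h2).trans (map_add g _ _).symm)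
  · intro c x hx h1
    exact (map_smul f c ⟨x, hx⟩).trans ((congrArg _ h1).trans (map_smul g _ _).symm)

/-- The generator of `M^λ`. -/
def permGen (lam : Weight n r) : (permSub K lam).toSubmodule :=
  permVec K lam (canonWord lam) (wt_canonWord lam)

theorem permRep_permVec_eq_permGen (lam : Weight n r) {k : Fin r → Fin n} (hk : wt k = lam.1)
    {π : Equiv.Perm (Fin r)} (hπ : k ∘ π = canonWord lam) :
    permRep K lam (.op π) (permVec K lam k hk) = permGen K lam :=
  permRep_permVec K lam hk _ π hπ

variable {K} in
/-- A homomorphism from `M^μ` is determined by the image of the generator. -/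
theorem heckeHom_ext {lam mu : Weight n r} {f g : HeckeHom K lam mu}
    (h : f (permGen K mu) = g (permGen K mu)) : f = g := by
  refine Representation.IntertwiningMap.ext (permSub_hom_ext fun k hk => ?_)
  obtain ⟨π, hπ⟩ := exists_comp_eq_canonWord mu hk
  have hπ' : canonWord mu ∘ ⇑π⁻¹ = k := by
    rw [← hπ]
    funext p
    simp
  change f _ = g _
  rw [← permRep_permVec K mu (wt_canonWord mu) hk _ hπ', f.isIntertwining, g.isIntertwining]
  exact congrArg _ h

/-- A linear map on tensor space factors through `S^λ E` if it is constant on the basis vectors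
with the same image in `S^λ E`. -/
theorem exists_comp_toSym {W : Type*} [AddCommGroup W] [Module K W] (lam : Weight n r)
    (g : TensorSpace K n r →ₗ[K] W)
    (hg : ∀ i i', expo lam i = expo lam i' →
      g (tensorBasis K n r i) = g (tensorBasis K n r i')) :
    ∃ f : GenSymPower K lam →ₗ[K] W, ∀ x, f (toSym K lam x) = g x := by
  choose s hs using expo_surjective (n := n) lam
  refine ⟨(genSymBasis K lam).constr K fun p => g (tensorBasis K n r (s p)), fun x => ?_⟩
  have : ((genSymBasis K lam).constr K fun p => g (tensorBasis K n r (s p))) ∘ₗ toSym K lam =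
      g := by
    refine (tensorBasis K n r).ext fun i => ?_
    rw [LinearMap.comp_apply, toSym_tensorBasis, Module.Basis.constr_basis]
    exact hg _ _ (hs _)
  exact LinearMap.congr_fun this x

variable {K} in
-- This invariance is what lets x ↦ x ⊗ f(generator) factor through S^μ E.
theorem heckeHom_permGen_stab {lam mu : Weight n r} (f : HeckeHom K lam mu)
    {π : Equiv.Perm (Fin r)} (hπ : canonWord mu ∘ π = canonWord mu) :
    placeRep K n r (.op π) (f (permGen K mu)) = f (permGen K mu) := by
  have h := f.isIntertwining _ _ (.op π) (permGen K mu)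
  rw [permGen, permRep_permVec K mu _ (wt_canonWord mu) π hπ] at h
  exact congrArg Subtype.val h.symm

variable {K} in
theorem exists_schurHom {lam mu : Weight n r} (f : HeckeHom K lam mu) :
    ∃ F : GenSymPower K mu →ₗ[SchurAlgebra K n r] GenSymPower K lam,
      ∀ x, F (toSym K mu x) = pairing K lam (f (permGen K mu)) x := by
  obtain ⟨F, hF⟩ := exists_comp_toSym K mu (pairing K lam (f (permGen K mu))) fun i i' h => by
    -- Basis tensors with the same image differ by a π that fixes the generator, hence fixes
    -- f(generator); the pairing is unchanged when π acts on both arguments.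
    obtain ⟨π, h1, rfl⟩ := exists_perm_of_pairCount_eq ((expo_eq_iff mu i i').1 h)
    rw [← placeRep_tensorBasis, ← heckeHom_permGen_stab f h1, pairing_placeRep,
      heckeHom_permGen_stab f h1]
  refine ⟨{ F with map_smul' := fun ξ y => ?_ }, hF⟩
  obtain ⟨x, rfl⟩ := toSym_surjective K mu y
  change F (ξ • toSym K mu x) = ξ • F (toSym K mu x)
  rw [smul_toSym, hF, hF, pairing_schur]

variable {K} in
/-- The homomorphism `S^μ E → S^λ E` induced by a homomorphism `M^μ → M^λ` on the
`Σ_r`-coinvariants of `E^{⊗ r} ⊗ M^μ` and `E^{⊗ r} ⊗ M^λ`. -/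
def schurHom {lam mu : Weight n r} (f : HeckeHom K lam mu) :
    GenSymPower K mu →ₗ[SchurAlgebra K n r] GenSymPower K lam :=
  (exists_schurHom f).choose

variable {K} in
theorem schurHom_toSym {lam mu : Weight n r} (f : HeckeHom K lam mu) (x : TensorSpace K n r) :
    schurHom f (toSym K mu x) = pairing K lam (f (permGen K mu)) x :=
  (exists_schurHom f).choose_spec x

variable {K} in
-- Moving e_k to the generator by a place permutation, applied to both factors, reduces to the
-- defining case. The formula x ⊗ m ↦ x ⊗ f(m) makes functoriality evident.
theorem schurHom_pairing {lam mu : Weight n r} (f : HeckeHom K lam mu)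
    (m : (permSub K mu).toSubmodule) (x : TensorSpace K n r) :
    schurHom f (pairing K mu m x) = pairing K lam (f m) x := by
  have : (schurHom f).restrictScalars K ∘ₗ (pairing K mu).flip x ∘ₗ Submodule.subtype _ =
      (pairing K lam).flip x ∘ₗ Submodule.subtype _ ∘ₗ f.toLinearMap := by
    refine permSub_hom_ext fun k hk => ?_
    change schurHom f (pairing K mu (tensorBasis K n r k) x) =
      pairing K lam (f (permVec K mu k hk)) x
    obtain ⟨π, hπ⟩ := exists_comp_eq_canonWord mu hk
    rw [pairing_tensorBasis, pairWord_of_comp K mu hπ, schurHom_toSym,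
      ← permRep_permVec_eq_permGen K mu hk hπ, f.isIntertwining]
    exact pairing_placeRep K lam π _ x
  exact LinearMap.congr_fun this m

variable {K} in
theorem schurHom_comp {lam mu nu : Weight n r} (f : HeckeHom K lam mu) (g : HeckeHom K mu nu) :
    schurHom (f.comp g) = schurHom f ∘ₗ schurHom g := by
  refine LinearMap.ext fun y => ?_
  obtain ⟨x, rfl⟩ := toSym_surjective K nu y
  rw [LinearMap.comp_apply, schurHom_toSym, schurHom_toSym, schurHom_pairing]
  rfl

theorem schurHom_one (lam : Weight n r) : schurHom (1 : HeckeAlgebra K lam) = 1 := by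
  refine LinearMap.ext fun y => ?_
  obtain ⟨x, rfl⟩ := toSym_surjective K lam y
  rw [schurHom_toSym]
  exact pairing_canonWord K lam x

/-- `schurHom` as a linear map. -/
def schurHomLinear (lam mu : Weight n r) :
    HeckeHom K lam mu →ₗ[K] (GenSymPower K mu →ₗ[SchurAlgebra K n r] GenSymPower K lam) where
  toFun := schurHom
  map_add' f g := by
    refine LinearMap.ext fun y => ?_
    obtain ⟨x, rfl⟩ := toSym_surjective K mu y
    rw [LinearMap.add_apply, schurHom_toSym, schurHom_toSym, schurHom_toSym,
      ← LinearMap.add_apply, ← map_add]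
    rfl
  map_smul' c f := by
    refine LinearMap.ext fun y => ?_
    obtain ⟨x, rfl⟩ := toSym_surjective K mu y
    rw [RingHom.id_apply, LinearMap.smul_apply, schurHom_toSym, schurHom_toSym,
      ← LinearMap.smul_apply, ← map_smul]
    rfl

/-! ### Bijectivity: recovering a homomorphism of permutation modules -/

theorem diagCoord_pairing_eq_repr (lam : Weight n r) (m : (permSub K lam).toSubmodule)
    (i : Fin r → Fin n) :
    diagCoord K lam (pairing K lam m (tensorBasis K n r i)) = (tensorBasis K n r).repr m i := by
  classical
  have : diagCoord K lam ∘ₗ (pairing K lam).flip (tensorBasis K n r i) ∘ₗ Submodule.subtype _ =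
      (tensorBasis K n r).coord i ∘ₗ Submodule.subtype (permSub K lam).toSubmodule := by
    refine permSub_hom_ext fun k hk => ?_
    change diagCoord K lam (pairing K lam (tensorBasis K n r k) (tensorBasis K n r i)) =
      (tensorBasis K n r).repr (tensorBasis K n r k) i
    rw [diagCoord_pairing, Module.Basis.repr_self, Finsupp.single_apply]
    simp only [hk, and_true, eq_comm]
  exact LinearMap.congr_fun this m

theorem schurHomLinear_injective (lam mu : Weight n r) :
    Function.Injective (schurHomLinear K lam mu) := by
  intro f g h
  refine heckeHom_ext (Subtype.ext ((tensorBasis K n r).ext_elem fun i => ?_))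
  rw [← diagCoord_pairing_eq_repr, ← diagCoord_pairing_eq_repr, ← schurHom_toSym,
    ← schurHom_toSym]
  exact congrArg _ (LinearMap.congr_fun h _)

/-- The element of the Schur algebra, with image in `M^λ`, whose restriction to `M^μ` induces a
given homomorphism `S^μ E → S^λ E`. -/
def schurOfHom {lam mu : Weight n r}
    (h : GenSymPower K mu →ₗ[SchurAlgebra K n r] GenSymPower K lam) : SchurAlgebra K n r :=
  -- The entry is forced: if h is induced by f, it is the coefficient of e_l in f(e_k) for k of
  -- weight μ. The cutoff puts the image inside M^λ by construction and loses nothing, because h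
  -- preserves weights.
  schurOfMatrix K (fun l k => if wt l = lam.1 then
      diagCoord K lam (h (pairing K mu (tensorBasis K n r k) (tensorBasis K n r l))) else 0)
    fun l k π => by
      rw [wt_comp, ← placeRep_tensorBasis, ← placeRep_tensorBasis, pairing_placeRep]

theorem schurOfHom_mem {lam mu : Weight n r}
    (h : GenSymPower K mu →ₗ[SchurAlgebra K n r] GenSymPower K lam) (x : TensorSpace K n r) :
    schurOfHom K h x ∈ (permSub K lam).toSubmodule := by
  have : LinearMap.range (schurOfHom K h).toLinearMap ≤ (permSub K lam).toSubmodule := by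
    rw [LinearMap.range_eq_map, ← (tensorBasis K n r).span_eq, Submodule.map_span,
      Submodule.span_le]
    rintro _ ⟨_, ⟨k, rfl⟩, rfl⟩
    change schurOfHom K h (tensorBasis K n r k) ∈ (permSub K lam).toSubmodule
    rw [schurOfHom, schurOfMatrix_tensorBasis]
    refine Submodule.sum_mem _ fun l _ => ?_
    split_ifs with hl
    · exact Submodule.smul_mem _ _ (tensorBasis_mem_permSub K lam hl)
    · rw [zero_smul]
      exact Submodule.zero_mem _
  exact this ⟨x, rfl⟩

/-- The homomorphism `M^μ → M^λ` that induces a given homomorphism `S^μ E → S^λ E`. -/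
def heckeOfHom {lam mu : Weight n r}
    (h : GenSymPower K mu →ₗ[SchurAlgebra K n r] GenSymPower K lam) : HeckeHom K lam mu where
  toLinearMap := (schurOfHom K h).toLinearMap.restrict fun x _ => schurOfHom_mem K h x
  isIntertwining' π := LinearMap.ext fun m =>
    Subtype.ext ((schurOfHom K h).isIntertwining _ _ π m.1)

theorem heckeOfHom_permGen {lam mu : Weight n r}
    (h : GenSymPower K mu →ₗ[SchurAlgebra K n r] GenSymPower K lam) :
    (heckeOfHom K h (permGen K mu) : TensorSpace K n r) =
      schurOfHom K h (tensorBasis K n r (canonWord mu)) := rfl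

theorem schurHomLinear_surjective (lam mu : Weight n r) :
    Function.Surjective (schurHomLinear K lam mu) := by
  intro h
  refine ⟨heckeOfHom K h, schurHom_ext K fun i => ?_⟩
  change diagCoord K lam (schurHom (heckeOfHom K h) _) = _
  rw [schurHom_toSym, diagCoord_pairing_eq_repr, heckeOfHom_permGen]
  change entry (schurOfHom K h) i (canonWord mu) = _
  rw [schurOfHom, entry_schurOfMatrix, pairing_canonWord]
  split_ifs with hi
  · rfl
  -- Outside weight λ the cutoff gives 0, which agrees with the true value.
  · rw [diagCoord_eq_zero_of_wt_ne K h hi]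

/-- `schurHom` as a linear isomorphism. -/
def schurHomEquiv (lam mu : Weight n r) :
    HeckeHom K lam mu ≃ₗ[K] (GenSymPower K mu →ₗ[SchurAlgebra K n r] GenSymPower K lam) :=
  LinearEquiv.ofBijective (schurHomLinear K lam mu)
    ⟨schurHomLinear_injective K lam mu, schurHomLinear_surjective K lam mu⟩

/-- `schurHom` as an isomorphism of endomorphism algebras. -/
def schurEndEquiv (lam : Weight n r) :
    HeckeAlgebra K lam ≃ₐ[K] Module.End (SchurAlgebra K n r) (GenSymPower K lam) :=
  AlgEquiv.ofLinearEquiv (schurHomEquiv K lam lam) (schurHom_one K lam) schurHom_comp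

end HeckeSchur

end

/-! ### Assembly of the isomorphisms -/

theorem mainTheorem2 (K : Type*) [Field K] [Infinite K] (n r : ℕ) :
    ∃ (φ : ∀ lam : Weight n r,
          HeckeAlgebra K lam ≃ₐ[K] Module.End (SchurAlgebra K n r) (GenSymPower K lam))
      (θ : ∀ lam : Weight n r,
          Module.End (SchurAlgebra K n r) (GenSymPower K lam) ≃ₐ[K]
            Representation.IntertwiningMap (glRep K lam) (glRep K lam)),
      (∀ (lam : Weight n r) (f : Module.End (SchurAlgebra K n r) (GenSymPower K lam))
          (x : GenSymPower K lam), θ lam f x = f x) ∧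
      ∀ lam mu : Weight n r,
        ∃ (ψ : HeckeHom K lam mu ≃ₗ[K]
              (GenSymPower K mu →ₗ[SchurAlgebra K n r] GenSymPower K lam))
          (χ : (GenSymPower K mu →ₗ[SchurAlgebra K n r] GenSymPower K lam) ≃ₗ[K]
              Representation.IntertwiningMap (glRep K mu) (glRep K lam)),
          (∀ (f : GenSymPower K mu →ₗ[SchurAlgebra K n r] GenSymPower K lam)
              (x : GenSymPower K mu), χ f x = f x) ∧
          (∀ (a : HeckeAlgebra K lam) (f : HeckeHom K lam mu) (b : HeckeAlgebra K mu),
            ψ (a.comp (f.comp b)) = φ lam a ∘ₗ ψ f ∘ₗ φ mu b) ∧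
          (∀ (a : HeckeAlgebra K lam) (f : HeckeHom K lam mu) (b : HeckeAlgebra K mu),
            χ (ψ (a.comp (f.comp b))) =
              (θ lam (φ lam a)).comp ((χ (ψ f)).comp (θ mu (φ mu b)))) := by
  refine ⟨schurEndEquiv K, endGL K, fun _ _ _ => rfl, fun lam mu =>
    ⟨schurHomEquiv K lam mu, homGL K lam mu, fun _ _ => rfl, fun a f b => ?_, fun a f b => ?_⟩⟩
  -- Both bimodule identities are functoriality applied twice; passing to GL_n leaves the underlying
  -- maps, and so their composites, unchanged.
  · change schurHom (a.comp (f.comp b)) = _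
    rw [schurHom_comp, schurHom_comp]
    rfl
  · change homGL K lam mu (schurHom (a.comp (f.comp b))) = _
    rw [schurHom_comp, schurHom_comp]
    rfl
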